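/- All graphs are finite, simple, undirected and connected. The distance spectrum of a graph $G$ is the multiset of eigenvalues (with multiplicity) of its distance matrix $D(G)=(d_G(u,v))_{u,v\in V(G)}$, where $d_G(u,v)$ is the distance between $u$ and $v$ in $G$. For an integer $k\ge 1$ let $F_n^k$ be the friendship graph on $n=2k+1$ vertices, that is, the graph consisting of $k$ triangles that share one common vertex and are otherwise disjoint. **Theorem.** For every $k\ge 1$ the friendship graph $F_n^k$ is determined by its distance spectrum: every connected graph $G$ that has the same distance spectrum as $F_n^k$ is isomorphic to $F_n^k$. -/

import Mathlib

universe u v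

/-- The distance matrix of a graph: the `(u, v)` entry is the distance between `u` and `v`. -/
noncomputable def SimpleGraph.distanceMatrix {V : Type*} (G : SimpleGraph V) : Matrix V V ℝ :=
  Matrix.of fun u v => (G.dist u v : ℝ)

/-- The distance spectrum of a (connected, finite) graph: the eigenvalues of its distance matrix
with multiplicity, as the multiset of roots of the characteristic polynomial. -/
noncomputable def SimpleGraph.distanceSpectrum {V : Type*} [Fintype V] [DecidableEq V]
    (G : SimpleGraph V) : Multiset ℝ :=
  G.distanceMatrix.charpoly.roots

/-- The distance matrix is real symmetric. -/
theorem SimpleGraph.isHermitian_distanceMatrix {V : Type*} (G : SimpleGraph V) :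
    G.distanceMatrix.IsHermitian := by
  ext u v
  simp [SimpleGraph.distanceMatrix, SimpleGraph.dist_comm]

/-- All eigenvalues of the distance matrix are real, so that the distance spectrum consists of as
many numbers as the graph has vertices. -/
theorem SimpleGraph.card_distanceSpectrum {V : Type*} [Fintype V] [DecidableEq V]
    (G : SimpleGraph V) : Multiset.card G.distanceSpectrum = Fintype.card V := by
  rw [SimpleGraph.distanceSpectrum,
    G.isHermitian_distanceMatrix.roots_charpoly_eq_eigenvalues]
  simp

/-- A graph `G` is determined by its distance spectrum if every finite connected graph with the
same distance spectrum as `G` is isomorphic to `G`. -/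
def SimpleGraph.IsDeterminedByDistanceSpectrum {V : Type u} [Fintype V] [DecidableEq V]
    (G : SimpleGraph V) : Prop :=
  ∀ (W : Type v) [Fintype W] [DecidableEq W] (H : SimpleGraph W),
    H.Connected → H.distanceSpectrum = G.distanceSpectrum → Nonempty (H ≃g G)

/-- The vertex set of the `i`-th triangle of the friendship graph: the common vertex `none`
and two further vertices. -/
def friendshipTriangle (k : ℕ) (i : Fin k) : Finset (Option (Fin k × Bool)) :=
  {none, some (i, false), some (i, true)}

/-- The friendship graph on `2 * k + 1` vertices: `k` triangles with a common vertex. -/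
def friendshipGraph (k : ℕ) : SimpleGraph (Option (Fin k × Bool)) where
  Adj u v := u ≠ v ∧ ∃ i : Fin k, u ∈ friendshipTriangle k i ∧ v ∈ friendshipTriangle k i
  symm := ⟨fun _ _ h => ⟨h.1.symm, h.2.imp fun _ hi => hi.symm⟩⟩
  loopless := ⟨fun _ h => h.1 rfl⟩

/-- The friendship graph is connected, so that its distances are genuine. -/
theorem friendshipGraph_connected (k : ℕ) : (friendshipGraph k).Connected := by
  have key : ∀ v, (friendshipGraph k).Reachable none v := by
    rintro (_ | ⟨i, b⟩)
    · exact SimpleGraph.Reachable.refl _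
    · refine SimpleGraph.Adj.reachable ⟨by simp, i, ?_, ?_⟩
      · simp [friendshipTriangle]
      · cases b <;> simp [friendshipTriangle]
  exact ⟨fun u v => (key u).symm.trans (key v)⟩

/-! Let `M = (D + 1)(D + 3) = (D + 2)² - 1`. For the friendship graph all but at most two
eigenvalues of `D` are -1 or -3, so `M` has rank at most two. The rank of `M` and the traces of `M`
and `M²` depend only on the spectrum. So for a cospectral graph, too, `M` is the Gram matrix of
plane vectors `P v = (x v, y v)`, and the squares of the `y v` sum to at most 5/4
(`exists_gram_of_distanceSpectrum_eq_friendshipGraph`).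

No eigenvalue lies below -3, which forces diameter at most two (`dist_le_two_of_posSemidef`). The
entries of `M` are then given by degrees and common neighbours: the trace fixes the number of edges,
and `|P u - P v|² = deg u + deg v - 2 - 2c` for `u ≠ v` with `c` common neighbours. Plane geometry
turns this into the conditions of `FriendshipLike`.

The rest is combinatorial. Without a dominating vertex there are at least three vertices of degree
two, any two with exactly one common neighbour; so they form a triangle pattern or a star, and both
are impossible (`false_of_triangle`, `false_of_star`). With a dominating vertex, all other degrees
are two, which describes a friendship graph. -/

open Matrix

/-- A real symmetric matrix is orthogonally diagonalizable, with its eigenvalues on the diagonal. -/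
theorem Matrix.IsHermitian.exists_orthogonal_diagonal {V : Type*} [Fintype V] [DecidableEq V]
    {A : Matrix V V ℝ} (hA : A.IsHermitian) :
    ∃ U : Matrix V V ℝ, U * Uᵀ = 1 ∧ Uᵀ * U = 1 ∧ A = U * diagonal hA.eigenvalues * Uᵀ := by
  refine ⟨hA.eigenvectorUnitary, ?_, ?_, ?_⟩
  · have := Unitary.coe_mul_star_self hA.eigenvectorUnitary
    rwa [Unitary.coe_star, star_eq_conjTranspose, conjTranspose_eq_transpose_of_trivial] at this
  · have := Unitary.coe_star_mul_self hA.eigenvectorUnitary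
    rwa [star_eq_conjTranspose, conjTranspose_eq_transpose_of_trivial] at this
  · have := hA.spectral_theorem
    rw [Unitary.conjStarAlgAut_apply, star_eq_conjTranspose,
      conjTranspose_eq_transpose_of_trivial] at this
    simpa using this

/-! ### Spectral invariants and the planar Gram representation -/

namespace SimpleGraph

section

variable {V : Type*} {W : Type*} [Fintype V] [DecidableEq V] [Fintype W] [DecidableEq W]

theorem sum_eigenvalues_eq_of_distanceSpectrum_eq {H : SimpleGraph W} {G : SimpleGraph V}
    (h : H.distanceSpectrum = G.distanceSpectrum) (g : ℝ → ℝ) :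
    ∑ i, g (H.isHermitian_distanceMatrix.eigenvalues i) =
      ∑ j, g (G.isHermitian_distanceMatrix.eigenvalues j) := by
  rw [distanceSpectrum, distanceSpectrum,
    H.isHermitian_distanceMatrix.roots_charpoly_eq_eigenvalues,
    G.isHermitian_distanceMatrix.roots_charpoly_eq_eigenvalues] at h
  have := congrArg (fun s => (s.map g).sum) h
  simpa [Multiset.map_map, Function.comp_def] using this

theorem exists_eigenvalue_eq_of_distanceSpectrum_eq {H : SimpleGraph W} {G : SimpleGraph V}
    (h : H.distanceSpectrum = G.distanceSpectrum) (i : W) :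
    ∃ j, G.isHermitian_distanceMatrix.eigenvalues j =
      H.isHermitian_distanceMatrix.eigenvalues i := by
  rw [distanceSpectrum, distanceSpectrum,
    H.isHermitian_distanceMatrix.roots_charpoly_eq_eigenvalues,
    G.isHermitian_distanceMatrix.roots_charpoly_eq_eigenvalues] at h
  have hi : H.isHermitian_distanceMatrix.eigenvalues i ∈
      Multiset.map (RCLike.ofReal ∘ H.isHermitian_distanceMatrix.eigenvalues)
        (Finset.univ (α := W)).val :=
    Multiset.mem_map.2 ⟨i, Finset.mem_univ i, rfl⟩
  rw [h] at hi
  obtain ⟨j, -, hj⟩ := Multiset.mem_map.1 hi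
  exact ⟨j, hj⟩

/-- The matrix `(D + 1) (D + 3)`, where `D` is the distance matrix. -/
noncomputable def shiftedSquare (G : SimpleGraph V) : Matrix V V ℝ :=
  (G.distanceMatrix + 2) * (G.distanceMatrix + 2) - 1

theorem shiftedSquare_eq (G : SimpleGraph V) :
    ∃ U : Matrix V V ℝ, U * Uᵀ = 1 ∧ Uᵀ * U = 1 ∧
      G.shiftedSquare = U * diagonal
        (fun i => (G.isHermitian_distanceMatrix.eigenvalues i + 2) ^ 2 - 1) * Uᵀ := by
  obtain ⟨U, h1, h2, h3⟩ := G.isHermitian_distanceMatrix.exists_orthogonal_diagonal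
  refine ⟨U, h1, h2, ?_⟩
  set e := G.isHermitian_distanceMatrix.eigenvalues with he
  have h4 : G.distanceMatrix + 2 = U * (diagonal e + 2) * Uᵀ := by
    rw [mul_add, add_mul, ← h3, mul_two U, add_mul, h1, one_add_one_eq_two]
  have h5 : (diagonal fun i => (e i + 2) ^ 2 - 1) =
      (diagonal e + 2) * (diagonal e + 2) - (1 : Matrix V V ℝ) := by
    have : (2 : Matrix V V ℝ) = diagonal fun _ => (2 : ℝ) := by
      ext i j; simp [Matrix.ofNat_apply, diagonal_apply]
    rw [this, diagonal_add, diagonal_mul_diagonal, ← diagonal_one, diagonal_sub]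
    congr 1; ext i; ring
  rw [shiftedSquare, h4, h5, mul_sub, sub_mul, mul_one, h1]
  congr 1
  calc U * (diagonal e + 2) * Uᵀ * (U * (diagonal e + 2) * Uᵀ)
      = U * (diagonal e + 2) * (Uᵀ * U) * (diagonal e + 2) * Uᵀ := by
        simp only [Matrix.mul_assoc]
    _ = _ := by rw [h2, Matrix.mul_one]; simp only [Matrix.mul_assoc]

theorem trace_shiftedSquare (G : SimpleGraph V) :
    G.shiftedSquare.trace =
      ∑ i, ((G.isHermitian_distanceMatrix.eigenvalues i + 2) ^ 2 - 1) := by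
  obtain ⟨U, h1, h2, h3⟩ := G.shiftedSquare_eq
  rw [h3, trace_mul_comm, ← Matrix.mul_assoc, h2, Matrix.one_mul, trace_diagonal]

theorem trace_shiftedSquare_mul_self (G : SimpleGraph V) :
    (G.shiftedSquare * G.shiftedSquare).trace =
      ∑ i, ((G.isHermitian_distanceMatrix.eigenvalues i + 2) ^ 2 - 1) ^ 2 := by
  obtain ⟨U, h1, h2, h3⟩ := G.shiftedSquare_eq
  set d := diagonal fun i => (G.isHermitian_distanceMatrix.eigenvalues i + 2) ^ 2 - 1 with hd
  have : G.shiftedSquare * G.shiftedSquare = U * (d * d) * Uᵀ := by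
    calc _ = U * d * (Uᵀ * U) * d * Uᵀ := by rw [h3]; simp only [Matrix.mul_assoc]
      _ = _ := by rw [h2, Matrix.mul_one]; simp only [Matrix.mul_assoc]
  rw [this, trace_mul_comm, ← Matrix.mul_assoc, h2, Matrix.one_mul, hd, diagonal_mul_diagonal,
    trace_diagonal]
  simp [sq]

theorem rank_shiftedSquare (G : SimpleGraph V) :
    (G.shiftedSquare.rank : ℝ) =
      ∑ i, if (G.isHermitian_distanceMatrix.eigenvalues i + 2) ^ 2 - 1 = 0 then 0 else 1 := by
  obtain ⟨U, h1, h2, h3⟩ := G.shiftedSquare_eq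
  have hU : IsUnit U.det := by
    have := congrArg det h1
    rw [det_mul, det_one] at this
    exact IsUnit.of_mul_eq_one _ this
  have hU' : IsUnit Uᵀ.det := by rwa [det_transpose]
  rw [h3, rank_mul_eq_left_of_isUnit_det _ _ hU', rank_mul_eq_right_of_isUnit_det _ _ hU,
    rank_diagonal, Fintype.card_subtype, Finset.sum_ite]
  simp

/-- If `(D + 1) (D + 3)` has rank at most two, then suitable bounds on the traces of this matrix and
of its square make it a Gram matrix of vectors in the plane that lie close to a line. -/
theorem exists_gram_of_spectral_data (G : SimpleGraph V) {t : ℝ} {T₁ T₂ : ℝ}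
    (hcard : 2 ≤ Fintype.card V)
    (hrank : G.shiftedSquare.rank ≤ 2) (h₁ : G.shiftedSquare.trace = T₁)
    (h₂ : (G.shiftedSquare * G.shiftedSquare).trace = T₂) (hT₁ : 0 < T₁) (hT₂ : T₂ ≤ T₁ ^ 2)
    (ht : (T₁ ^ 2 - T₂) / 2 - t * T₁ + t ^ 2 ≤ 0) :
    ∃ x y : V → ℝ, (∀ u v, G.shiftedSquare u v = x u * x v + y u * y v) ∧
      ∑ v, y v ^ 2 ≤ t := by
  obtain ⟨U, hU1, hU2, hU3⟩ := G.shiftedSquare_eq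
  rw [trace_shiftedSquare] at h₁
  rw [trace_shiftedSquare_mul_self] at h₂
  have hr := G.rank_shiftedSquare
  set f : V → ℝ := fun i => (G.isHermitian_distanceMatrix.eigenvalues i + 2) ^ 2 - 1 with hf
  change G.shiftedSquare = U * diagonal f * Uᵀ at hU3
  change ∑ i, f i = T₁ at h₁
  change ∑ i, f i ^ 2 = T₂ at h₂
  have hr' : (Finset.univ.filter fun i => f i ≠ 0).card ≤ 2 := by
    have : (((Finset.univ.filter fun i => f i ≠ 0).card : ℕ) : ℝ) ≤ 2 := by
      have h2 : (G.shiftedSquare.rank : ℝ) ≤ 2 := by exact_mod_cast hrank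
      rw [hr, Finset.sum_ite] at h2
      simpa using h2
    exact_mod_cast this
  -- Padding the support to exactly two indices avoids a separate treatment of rank below two.
  obtain ⟨s, hs1, hs2⟩ := Finset.exists_superset_card_eq hr' hcard
  obtain ⟨i, j, hij, rfl⟩ := Finset.card_eq_two.1 hs2
  have h0 : ∀ l, l ∉ ({i, j} : Finset V) → f l = 0 := fun l hl => by
    by_contra h
    exact hl (hs1 (by simp [h]))
  have hsum : ∀ g : V → ℝ, (∀ l, l ∉ ({i, j} : Finset V) → g l = 0) → ∑ l, g l = g i + g j := by
    intro g hg
    rw [← Finset.sum_subset (Finset.subset_univ {i, j}) fun l _ hl => hg l hl, Finset.sum_pair hij]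
  rw [hsum f h0] at h₁
  rw [hsum _ fun l hl => by simp [h0 l hl]] at h₂
  have hM : ∀ u v, G.shiftedSquare u v = f i * (U u i * U v i) + f j * (U u j * U v j) := by
    intro u v
    rw [hU3, mul_apply, hsum]
    · simp only [mul_diagonal, transpose_apply]; ring
    · intro l hl
      simp [mul_diagonal, h0 l hl]
  have hcol : ∀ l, ∑ v, U v l ^ 2 = 1 := by
    intro l
    have := congrFun (congrFun hU2 l) l
    simpa [mul_apply, sq] using this
  have key : ∀ i j, f i + f j = T₁ → f i ^ 2 + f j ^ 2 = T₂ → f j ≤ f i →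
      (∀ u v, G.shiftedSquare u v = f i * (U u i * U v i) + f j * (U u j * U v j)) →
      ∃ x y : V → ℝ, (∀ u v, G.shiftedSquare u v = x u * x v + y u * y v) ∧
      ∑ v, y v ^ 2 ≤ t := by
    intro i j e1 e2 hle hM
    have hi : 0 ≤ f i := by linarith
    have hpq : 0 ≤ f i * f j := by
      have : 2 * (f i * f j) = T₁ ^ 2 - T₂ := by rw [← e1, ← e2]; ring
      linarith
    have hi' : 0 < f i := by linarith
    have hj : 0 ≤ f j := nonneg_of_mul_nonneg_right hpq hi'
    -- By `ht` the monic quadratic with roots `f i` and `f j` is nonpositive at `t`, so `t` lies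
    -- between them.
    have hjt : f j ≤ t := by
      by_contra! hlt
      have h1 : 0 < (f i - t) * (f j - t) := mul_pos (by linarith) (by linarith)
      have h2 : (f i - t) * (f j - t) = (T₁ ^ 2 - T₂) / 2 - t * T₁ + t ^ 2 := by
        rw [← e1, ← e2]; ring
      linarith
    refine ⟨fun u => √(f i) * U u i, fun u => √(f j) * U u j, fun u v => ?_, ?_⟩
    · rw [hM]
      have a1 := Real.mul_self_sqrt hi
      have a2 := Real.mul_self_sqrt hj
      linear_combination -(U u i * U v i) * a1 - (U u j * U v j) * a2
    · simp only [mul_pow, Real.sq_sqrt hj]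
      rw [← Finset.mul_sum, hcol, mul_one]
      exact hjt
  rcases le_total (f j) (f i) with h | h
  · exact key i j h₁ h₂ h hM
  · exact key j i (by linarith) (by linarith) h fun u v => by rw [hM]; ring

/-- Both sides say that no eigenvalue is below `-c`, which the spectrum decides. -/
theorem posSemidef_distanceMatrix_add_of_distanceSpectrum_eq {H : SimpleGraph W}
    {G : SimpleGraph V} (h : H.distanceSpectrum = G.distanceSpectrum) {c : ℝ}
    (hG : (G.distanceMatrix + c • (1 : Matrix V V ℝ)).PosSemidef) :
    (H.distanceMatrix + c • (1 : Matrix W W ℝ)).PosSemidef := by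
  have hge : ∀ i, 0 ≤ H.isHermitian_distanceMatrix.eigenvalues i + c := by
    intro i
    obtain ⟨j, hj⟩ := exists_eigenvalue_eq_of_distanceSpectrum_eq h i
    rw [← hj]
    obtain ⟨U, h1, h2, h3⟩ := G.isHermitian_distanceMatrix.exists_orthogonal_diagonal
    have h4 := (hG.conjTranspose_mul_mul_same U).diag_nonneg (i := j)
    have h5 : Uᴴ * (G.distanceMatrix + c • (1 : Matrix V V ℝ)) * U =
        diagonal G.isHermitian_distanceMatrix.eigenvalues + c • (1 : Matrix V V ℝ) := by
      rw [conjTranspose_eq_transpose_of_trivial, mul_add, add_mul]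
      congr 1
      · nth_rw 1 [h3]
        calc _ = (Uᵀ * U) * diagonal G.isHermitian_distanceMatrix.eigenvalues * (Uᵀ * U) := by
              simp only [Matrix.mul_assoc]
          _ = _ := by rw [h2, Matrix.one_mul, Matrix.mul_one]
      · simp [h2]
    rw [h5] at h4
    simpa using h4
  obtain ⟨U, h1, h2, h3⟩ := H.isHermitian_distanceMatrix.exists_orthogonal_diagonal
  have h5 : H.distanceMatrix + c • (1 : Matrix W W ℝ) =
      U * (diagonal fun i => H.isHermitian_distanceMatrix.eigenvalues i + c) * Uᴴ := by
    have : (diagonal fun i => H.isHermitian_distanceMatrix.eigenvalues i + c) =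
        diagonal H.isHermitian_distanceMatrix.eigenvalues + c • (1 : Matrix W W ℝ) := by
      rw [smul_one_eq_diagonal, diagonal_add]
    rw [this, conjTranspose_eq_transpose_of_trivial, mul_add, add_mul, ← h3]
    simp [h1]
  rw [h5]
  exact (PosSemidef.diagonal fun i => hge i).mul_mul_conjTranspose_same U

end

end SimpleGraph

/-! ### The distance matrix of the friendship graph -/

section

variable {k : ℕ}

theorem friendshipGraph_adj_none_some (p : Fin k × Bool) :
    (friendshipGraph k).Adj none (some p) := by
  obtain ⟨i, b⟩ := p
  refine ⟨by simp, i, ?_, ?_⟩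
  · simp [friendshipTriangle]
  · cases b <;> simp [friendshipTriangle]

theorem friendshipGraph_adj_some_some (p q : Fin k × Bool) :
    (friendshipGraph k).Adj (some p) (some q) ↔ q = (p.1, !p.2) := by
  obtain ⟨i, b⟩ := p
  obtain ⟨j, c⟩ := q
  constructor
  · rintro ⟨hne, l, h1, h2⟩
    cases b <;> cases c <;> simp_all [friendshipTriangle]
  · intro h
    simp only [Prod.mk.injEq] at h
    obtain ⟨rfl, rfl⟩ := h
    refine ⟨by simp, j, ?_, ?_⟩ <;> cases b <;> simp [friendshipTriangle]

theorem friendshipGraph_dist_some_some (p q : Fin k × Bool) (hpq : p ≠ q)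
    (h : q ≠ (p.1, !p.2)) : (friendshipGraph k).dist (some p) (some q) = 2 := by
  have hle : (friendshipGraph k).dist (some p) (some q) ≤ 2 :=
    SimpleGraph.dist_le (.cons (friendshipGraph_adj_none_some p).symm
      (.cons (friendshipGraph_adj_none_some q) .nil))
  have h0 : (friendshipGraph k).dist (some p) (some q) ≠ 0 := by
    rw [Ne, (friendshipGraph_connected k).dist_eq_zero_iff]
    simpa using hpq
  have h1 : (friendshipGraph k).dist (some p) (some q) ≠ 1 := by
    rw [Ne, SimpleGraph.dist_eq_one_iff_adj, friendshipGraph_adj_some_some]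
    exact h
  omega

theorem distanceMatrix_friendshipGraph_none_some (p : Fin k × Bool) :
    (friendshipGraph k).distanceMatrix none (some p) = 1 := by
  simp [SimpleGraph.distanceMatrix,
    SimpleGraph.dist_eq_one_iff_adj.2 (friendshipGraph_adj_none_some p)]

theorem distanceMatrix_friendshipGraph_some_none (p : Fin k × Bool) :
    (friendshipGraph k).distanceMatrix (some p) none = 1 := by
  simp [SimpleGraph.distanceMatrix,
    SimpleGraph.dist_eq_one_iff_adj.2 (friendshipGraph_adj_none_some p).symm]

theorem distanceMatrix_friendshipGraph_some_some (p q : Fin k × Bool) :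
    (friendshipGraph k).distanceMatrix (some p) (some q) =
      2 - (if p = q then 2 else 0) - if (p.1, !p.2) = q then 1 else 0 := by
  rw [SimpleGraph.distanceMatrix, of_apply]
  by_cases h1 : p = q
  · subst h1
    have : (p.1, !p.2) ≠ p := fun h => by simpa using congrArg Prod.snd h
    simp [this]
  by_cases h2 : q = (p.1, !p.2)
  · rw [SimpleGraph.dist_eq_one_iff_adj.2 ((friendshipGraph_adj_some_some p q).2 h2), if_neg h1,
      if_pos h2.symm]
    norm_num
  · rw [friendshipGraph_dist_some_some p q h1 h2, if_neg h1, if_neg (Ne.symm h2)]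
    norm_num

theorem flip_snd_eq_iff {α : Type*} (p q : α × Bool) : (p.1, !p.2) = q ↔ p = (q.1, !q.2) := by
  obtain ⟨i, b⟩ := p
  obtain ⟨j, c⟩ := q
  cases b <;> cases c <;> simp

/-- An explicit sum of squares: three rank-one terms plus `N`, which is the block `[[1, -1], [-1,
1]]` on each triangle without its centre and satisfies `N² = 2N`. -/
theorem posSemidef_distanceMatrix_friendshipGraph :
    ((friendshipGraph k).distanceMatrix +
      (3 : ℝ) • (1 : Matrix (Option (Fin k × Bool)) (Option (Fin k × Bool)) ℝ)).PosSemidef := by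
  set N : Matrix (Option (Fin k × Bool)) (Option (Fin k × Bool)) ℝ := of fun u v =>
    match u, v with
    | some p, some q => (if p = q then 1 else 0) - if (p.1, !p.2) = q then 1 else 0
    | _, _ => 0 with hN
  set a : Option (Fin k × Bool) → ℝ := fun u => if u = none then √2 else 0 with ha
  set b : Option (Fin k × Bool) → ℝ := fun u => if u = none then 0 else 1 with hb
  have hNN : Nᴴ * N = (2 : ℝ) • N := by
    ext u v
    rw [mul_apply, Fintype.sum_option]
    rcases u with _ | p <;> rcases v with _ | q
    · simp [hN]
    · simp [hN]
    · simp [hN]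
    · have hne : (p.1, !p.2) ≠ p := fun h => by simpa using congrArg Prod.snd h
      simp only [hN, conjTranspose_apply, of_apply, star_trivial, Matrix.smul_apply, mul_zero, zero_add,
        flip_snd_eq_iff _ p, sub_mul, ite_mul, one_mul, zero_mul, Finset.sum_sub_distrib,
        Finset.sum_ite_eq', Finset.mem_univ, if_true, Bool.not_not, smul_eq_mul]
      ring
  have hsum : (friendshipGraph k).distanceMatrix +
      (3 : ℝ) • (1 : Matrix (Option (Fin k × Bool)) (Option (Fin k × Bool)) ℝ) =
      vecMulVec (fun _ => 1) (star fun _ => 1) + vecMulVec a (star a) + vecMulVec b (star b) +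
        (1 / 2 : ℝ) • (Nᴴ * N) := by
    rw [hNN]
    ext u v
    rcases u with _ | p <;> rcases v with _ | q
    · simp [SimpleGraph.distanceMatrix, ha, hb, hN, vecMulVec_apply]
      norm_num
    · simp [distanceMatrix_friendshipGraph_none_some, ha, hb, hN, vecMulVec_apply]
    · simp [distanceMatrix_friendshipGraph_some_none, ha, hb, hN, vecMulVec_apply]
    · simp [distanceMatrix_friendshipGraph_some_some, ha, hb, hN, vecMulVec_apply, one_apply]
      split_ifs <;> norm_num
  rw [hsum]
  refine (((posSemidef_vecMulVec_self_star _).add (posSemidef_vecMulVec_self_star _)).add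
    (posSemidef_vecMulVec_self_star _)).add ?_
  exact (posSemidef_conjTranspose_mul_self N).smul (by norm_num)

/-- Entries depend only on which of the two vertices is the centre; this gives rank at most two. Off
the centre, `D + 2` is `2J - P` with `P` the partner involution, and the `1` from `P² = 1` is
cancelled by the `- 1`. -/
theorem shiftedSquare_friendshipGraph (u v : Option (Fin k × Bool)) :
    (friendshipGraph k).shiftedSquare u v =
      if u = none then (if v = none then 2 * (k : ℝ) + 3 else 4 * k + 1)
      else if v = none then 4 * k + 1 else 8 * (k : ℝ) - 3 := by
  have h2 : ∀ u v, ((friendshipGraph k).distanceMatrix + 2) u v =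
      (friendshipGraph k).distanceMatrix u v + if u = v then 2 else 0 := by
    intro u v
    rw [Matrix.add_apply, Matrix.ofNat_apply]
    split_ifs <;> simp
  have h3 : ∀ p q : Fin k × Bool, ((friendshipGraph k).distanceMatrix + 2) (some p) (some q) =
      2 - if (p.1, !p.2) = q then 1 else 0 := by
    intro p q
    rw [h2, distanceMatrix_friendshipGraph_some_some]
    simp only [Option.some.injEq]
    ring
  have h4 : ∀ p, ((friendshipGraph k).distanceMatrix + 2) none (some p) = 1 := fun p => by
    rw [h2, distanceMatrix_friendshipGraph_none_some]; simp
  have h5 : ∀ p, ((friendshipGraph k).distanceMatrix + 2) (some p) none = 1 := fun p => by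
    rw [h2, distanceMatrix_friendshipGraph_some_none]; simp
  have h6 : ((friendshipGraph k).distanceMatrix + 2) none none = 2 := by
    rw [h2]; simp [SimpleGraph.distanceMatrix]
  rw [SimpleGraph.shiftedSquare, Matrix.sub_apply, mul_apply, Fintype.sum_option]
  rcases u with _ | p <;> rcases v with _ | q
  · simp [h4, h5, h6]
    ring
  · simp only [h4, h6, h3, flip_snd_eq_iff _ q, one_mul, Finset.sum_sub_distrib, Finset.sum_ite_eq',
      Finset.mem_univ, if_true, Finset.sum_const, one_apply]
    simp
    ring
  · simp only [h5, h6, h3, mul_one, Finset.sum_sub_distrib, Finset.sum_ite_eq,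
      Finset.mem_univ, if_true, Finset.sum_const, one_apply]
    simp
    ring
  · simp only [h4, h5, h3, flip_snd_eq_iff _ q, sub_mul, mul_sub, ite_mul, mul_ite, mul_one, mul_zero,
      zero_mul, one_mul,
      Finset.sum_sub_distrib, Finset.sum_ite_eq, Finset.sum_ite_eq',
      Finset.mem_univ, if_true, Finset.sum_const, one_apply, Option.some.injEq]
    simp [flip_snd_eq_iff p]
    ring

theorem trace_shiftedSquare_friendshipGraph :
    (friendshipGraph k).shiftedSquare.trace = 16 * (k : ℝ) ^ 2 - 4 * k + 3 := by
  rw [trace, Fintype.sum_option]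
  simp [shiftedSquare_friendshipGraph]
  ring

/-- In this form the product of the two possibly nonzero eigenvalues can be read off: it is `20k(k -
1)`, half the difference between the squared trace and this trace. -/
theorem trace_shiftedSquare_mul_self_friendshipGraph :
    ((friendshipGraph k).shiftedSquare * (friendshipGraph k).shiftedSquare).trace =
      (16 * (k : ℝ) ^ 2 - 4 * k + 3) ^ 2 - 40 * k * (k - 1) := by
  rw [trace, Fintype.sum_option]
  simp only [diag_apply, mul_apply, Fintype.sum_option]
  simp [shiftedSquare_friendshipGraph]
  ring

theorem rank_shiftedSquare_friendshipGraph :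
    (friendshipGraph k).shiftedSquare.rank ≤ 2 := by
  have : (friendshipGraph k).shiftedSquare =
      (of fun u i => if i = (if u = none then (0 : Fin 2) else 1) then (1 : ℝ) else 0) *
      (of fun i v => if i = (0 : Fin 2) then (if v = none then 2 * (k : ℝ) + 3 else 4 * k + 1)
      else if v = none then 4 * k + 1 else 8 * (k : ℝ) - 3) := by
    ext u v
    rw [shiftedSquare_friendshipGraph, mul_apply, Fin.sum_univ_two]
    by_cases hu : u = none <;> simp [hu]
  rw [this]
  exact (rank_mul_le_left _ _).trans ((rank_le_card_width _).trans (by simp))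

end

/-! ### Consequences of cospectrality, and diameter two -/

namespace SimpleGraph

variable {W : Type*} [Fintype W] [DecidableEq W] {H : SimpleGraph W} {k : ℕ}

theorem card_eq_of_distanceSpectrum_eq_friendshipGraph
    (h : H.distanceSpectrum = (friendshipGraph k).distanceSpectrum) :
    Fintype.card W = 2 * k + 1 := by
  rw [← H.card_distanceSpectrum, h, card_distanceSpectrum]
  simp
  ring

theorem trace_shiftedSquare_eq_of_distanceSpectrum_eq_friendshipGraph
    (h : H.distanceSpectrum = (friendshipGraph k).distanceSpectrum) :
    H.shiftedSquare.trace = 16 * (k : ℝ) ^ 2 - 4 * k + 3 := by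
  rw [← trace_shiftedSquare_friendshipGraph, trace_shiftedSquare, trace_shiftedSquare]
  exact sum_eigenvalues_eq_of_distanceSpectrum_eq h fun t => (t + 2) ^ 2 - 1

/-- The eigenvalues have sum `16k² - 4k + 3` and product `20k(k - 1)`. The bound 5/4 is the ratio of
the leading coefficients, and at 5/4 the quadratic with these roots equals `-15k - 35/16`. -/
theorem exists_gram_of_distanceSpectrum_eq_friendshipGraph (hk : 1 ≤ k)
    (h : H.distanceSpectrum = (friendshipGraph k).distanceSpectrum) :
    ∃ x y : W → ℝ, (∀ u v, H.shiftedSquare u v = x u * x v + y u * y v) ∧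
      ∑ v, y v ^ 2 ≤ 5 / 4 := by
  have hk' : (1 : ℝ) ≤ k := by exact_mod_cast hk
  refine H.exists_gram_of_spectral_data (T₁ := 16 * (k : ℝ) ^ 2 - 4 * k + 3)
    (T₂ := (16 * (k : ℝ) ^ 2 - 4 * k + 3) ^ 2 - 40 * k * (k - 1)) ?_ ?_ ?_ ?_ ?_ ?_ ?_
  · rw [card_eq_of_distanceSpectrum_eq_friendshipGraph h]; omega
  · have h1 : (H.shiftedSquare.rank : ℝ) = (friendshipGraph k).shiftedSquare.rank := by
      rw [rank_shiftedSquare, rank_shiftedSquare]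
      exact sum_eigenvalues_eq_of_distanceSpectrum_eq h fun t =>
        if (t + 2) ^ 2 - 1 = 0 then 0 else 1
    have h2 : H.shiftedSquare.rank = (friendshipGraph k).shiftedSquare.rank := by exact_mod_cast h1
    exact h2 ▸ rank_shiftedSquare_friendshipGraph
  · exact trace_shiftedSquare_eq_of_distanceSpectrum_eq_friendshipGraph h
  · rw [← trace_shiftedSquare_mul_self_friendshipGraph, trace_shiftedSquare_mul_self,
      trace_shiftedSquare_mul_self]
    exact sum_eigenvalues_eq_of_distanceSpectrum_eq h fun t => ((t + 2) ^ 2 - 1) ^ 2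
  · nlinarith
  · nlinarith
  · nlinarith

/-- A connected graph whose distance matrix has no eigenvalue below `-3` has diameter at
most two. -/
theorem dist_le_two_of_posSemidef {W : Type*} [DecidableEq W] {H : SimpleGraph W}
    (hH : H.Connected)
    (hpsd : (H.distanceMatrix + (3 : ℝ) • (1 : Matrix W W ℝ)).PosSemidef) (u v : W) :
    H.dist u v ≤ 2 := by
  have step : ∀ n v, H.dist u v = n + 1 → ∃ w, H.Adj w v ∧ H.dist u w = n := by
    intro n v hn
    obtain ⟨p, hp⟩ := hH.exists_walk_length_eq_dist v u
    rw [dist_comm, hn] at hp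
    cases p with
    | nil => simp at hp
    | @cons _ w _ hvw q =>
      refine ⟨w, hvw.symm, ?_⟩
      have h1 : H.dist w u ≤ q.length := dist_le q
      have h2 : H.dist v u ≤ H.dist v w + H.dist w u := hH.dist_triangle
      rw [dist_eq_one_iff_adj.2 hvw, dist_comm, hn] at h2
      simp only [Walk.length_cons] at hp
      rw [dist_comm]
      omega
  have h3 : ∀ v, H.dist u v ≠ 3 := by
    intro v hv
    obtain ⟨w, hwv, hw⟩ := step 2 v hv
    obtain ⟨z, hzw, hz⟩ := step 1 w hw
    have hvz : H.dist z v = 2 := by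
      have h1 : H.dist u v ≤ H.dist u z + H.dist z v := hH.dist_triangle
      have h2 : H.dist z v ≤ H.dist z w + H.dist w v := hH.dist_triangle
      rw [dist_eq_one_iff_adj.2 hzw, dist_eq_one_iff_adj.2 hwv] at h2
      omega
    have hzw' := dist_eq_one_iff_adj.2 hzw
    have hwv' := dist_eq_one_iff_adj.2 hwv
    have huz : u ≠ z := by rintro rfl; simp at hz
    have huw : u ≠ w := by rintro rfl; simp at hw
    have huv : u ≠ v := by rintro rfl; simp at hv
    have hzv : z ≠ v := by rintro rfl; simp at hvz
    -- On the four vertices of a geodesic of length three this test vector gives the value -4.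
    have := (hpsd.submatrix ![u, z, w, v]).dotProduct_mulVec_nonneg ![2, 1, -1, -2]
    simp [dotProduct, mulVec, Fin.sum_univ_four, distanceMatrix, one_apply, hz, hw, hv, hvz, hzw',
      hwv', huz, huw, huv, hzv, hzw.ne, hwv.ne, H.dist_comm (u := z) (v := u), H.dist_comm (u := w) (v := u),
      H.dist_comm (u := v) (v := u), H.dist_comm (u := v) (v := z), H.dist_comm (u := w) (v := z),
      H.dist_comm (u := v) (v := w), huz.symm, huw.symm, huv.symm,
      hzv.symm, hzw.ne', hwv.ne'] at this
    norm_num at this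
  have : ∀ n v, H.dist u v ≠ n + 3 := by
    intro n
    induction n with
    | zero => simpa using h3
    | succ n ih =>
      intro v hv
      obtain ⟨w, -, hw⟩ := step (n + 3) v hv
      exact ih w hw
  by_contra! hlt
  obtain ⟨m, hm⟩ := Nat.exists_eq_add_of_lt hlt
  exact this m v (by omega)

open Classical in
theorem distanceMatrix_add_two_apply {W : Type*} [DecidableEq W] {H : SimpleGraph W}
    (hH : H.Connected) (hd : ∀ u v, H.dist u v ≤ 2) (u v : W) :
    (H.distanceMatrix + 2) u v = 2 - if H.Adj u v then 1 else 0 := by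
  rw [Matrix.add_apply, Matrix.ofNat_apply, distanceMatrix, of_apply]
  by_cases huv : u = v
  · subst huv; simp
  by_cases ha : H.Adj u v
  · rw [dist_eq_one_iff_adj.2 ha, if_pos ha, if_neg huv]; norm_num
  · have h0 : H.dist u v ≠ 0 := by rwa [Ne, hH.dist_eq_zero_iff]
    have h1 : H.dist u v ≠ 1 := by rwa [Ne, dist_eq_one_iff_adj]
    have h2 : H.dist u v = 2 := by have := hd u v; omega
    rw [h2, if_neg huv, if_neg ha]; norm_num

/-- In a graph of diameter at most two the matrix `(D + 1) (D + 3)` is expressed by degrees and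
numbers of common neighbours. -/
theorem shiftedSquare_apply [DecidableRel H.Adj] (hH : H.Connected)
    (hd : ∀ u v, H.dist u v ≤ 2) (u v : W) :
    H.shiftedSquare u v = 4 * Fintype.card W - 2 * H.degree u - 2 * H.degree v +
      (H.neighborFinset u ∩ H.neighborFinset v).card - if u = v then 1 else 0 := by
  have h1 : ∀ u, ∑ w, (if H.Adj u w then (1 : ℝ) else 0) = H.degree u := by
    intro u
    rw [Finset.sum_boole, ← card_neighborFinset_eq_degree, neighborFinset_eq_filter]
  have h2 : ∑ w, (if H.Adj u w then (1 : ℝ) else 0) * (if H.Adj w v then 1 else 0) =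
      (H.neighborFinset u ∩ H.neighborFinset v).card := by
    rw [neighborFinset_eq_filter, neighborFinset_eq_filter, ← Finset.filter_and,
      ← Finset.sum_boole]
    refine Finset.sum_congr rfl fun w _ => ?_
    simp only [H.adj_comm w v]
    by_cases h1 : H.Adj u w <;> by_cases h2 : H.Adj v w <;> simp [h1, h2]
  rw [shiftedSquare, Matrix.sub_apply, mul_apply, one_apply]
  congr 1
  calc _ = ∑ w, (4 - 2 * (if H.Adj u w then (1 : ℝ) else 0) - 2 * (if H.Adj v w then (1 : ℝ) else 0)
        + (if H.Adj u w then (1 : ℝ) else 0) * (if H.Adj w v then 1 else 0)) := by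
        refine Finset.sum_congr rfl fun w _ => ?_
        rw [distanceMatrix_add_two_apply hH hd, distanceMatrix_add_two_apply hH hd]
        simp only [H.adj_comm w v]
        split_ifs <;> norm_num
    _ = _ := by
        rw [Finset.sum_add_distrib, Finset.sum_sub_distrib, Finset.sum_sub_distrib,
          ← Finset.mul_sum, ← Finset.mul_sum, h1, h1, h2]
        simp
        ring

end SimpleGraph

/-! ### The combinatorial problem -/

namespace SimpleGraph

variable {V : Type*} [Fintype V] [DecidableEq V]

/-- The combinatorial consequences for a connected graph `G` of having the distance spectrum of the
friendship graph with `k` triangles. -/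
structure FriendshipLike (G : SimpleGraph V) [DecidableRel G.Adj] (k : ℕ) : Prop where
  card_eq : Fintype.card V = 2 * k + 1
  sum_degree : ∑ v, G.degree v = 6 * k
  exists_common : ∀ u v, u ≠ v → ¬ G.Adj u v → ∃ w, G.Adj u w ∧ G.Adj w v
  common_le : ∀ u v, u ≠ v →
    2 * (G.neighborFinset u ∩ G.neighborFinset v).card + 2 ≤ G.degree u + G.degree v
  twins : ∀ u v w d, u ≠ v → u ≠ w → v ≠ w → d ≤ 3 → G.degree u = d → G.degree v = d →
    G.degree w = d → (G.neighborFinset u ∩ G.neighborFinset v).card + 1 = d →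
    d ≤ (G.neighborFinset u ∩ G.neighborFinset w).card + 1
  not_equilateral : ∀ u v w d, u ≠ v → u ≠ w → v ≠ w → d ≤ 3 → G.degree u = d → G.degree v = d →
    G.degree w = d → (G.neighborFinset u ∩ G.neighborFinset v).card + 2 = d →
    (G.neighborFinset u ∩ G.neighborFinset w).card + 2 = d →
    (G.neighborFinset v ∩ G.neighborFinset w).card + 2 ≠ d

section

variable {G : SimpleGraph V} [DecidableRel G.Adj] {k : ℕ}

theorem adj_iff_of_degree_eq_one {V : Type*} [Fintype V] {G : SimpleGraph V}
    [DecidableRel G.Adj] {u a : V} (h : G.degree u = 1) (ha : G.Adj u a) (z : V) :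
    G.Adj u z ↔ z = a := by
  have : {a} = G.neighborFinset u := Finset.eq_of_subset_of_card_le (by simpa using ha)
    (by rw [card_neighborFinset_eq_degree, h]; simp)
  rw [← mem_neighborFinset, ← this]; simp

theorem adj_iff_of_degree_eq_two {u a b : V} (h : G.degree u = 2) (ha : G.Adj u a)
    (hb : G.Adj u b) (hab : a ≠ b) (z : V) : G.Adj u z ↔ z = a ∨ z = b := by
  have : {a, b} = G.neighborFinset u := Finset.eq_of_subset_of_card_le
    (by simp [Finset.insert_subset_iff, ha, hb])
    (by rw [card_neighborFinset_eq_degree, h, Finset.card_pair hab])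
  rw [← mem_neighborFinset, ← this]; simp

theorem adj_iff_of_degree_eq_three {u a b c : V} (h : G.degree u = 3) (ha : G.Adj u a)
    (hb : G.Adj u b) (hc : G.Adj u c) (hab : a ≠ b) (hac : a ≠ c) (hbc : b ≠ c) (z : V) :
    G.Adj u z ↔ z = a ∨ z = b ∨ z = c := by
  have : {a, b, c} = G.neighborFinset u := Finset.eq_of_subset_of_card_le
    (by simp [Finset.insert_subset_iff, ha, hb, hc])
    (by rw [card_neighborFinset_eq_degree, h, Finset.card_eq_three.2 ⟨a, b, c, hab, hac, hbc, rfl⟩])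
  rw [← mem_neighborFinset, ← this]; simp

theorem card_common_eq_zero {u v : V} (h : ∀ z, G.Adj u z → ¬ G.Adj v z) :
    (G.neighborFinset u ∩ G.neighborFinset v).card = 0 := by
  rw [Finset.card_eq_zero]; ext z; simpa using h z

theorem card_common_eq_one {u v a : V} (h : ∀ z, G.Adj u z ∧ G.Adj v z ↔ z = a) :
    (G.neighborFinset u ∩ G.neighborFinset v).card = 1 := by
  rw [Finset.card_eq_one]; exact ⟨a, by ext z; simpa using h z⟩

theorem card_common_eq_two {u v a b : V} (hab : a ≠ b)
    (h : ∀ z, G.Adj u z ∧ G.Adj v z ↔ z = a ∨ z = b) :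
    (G.neighborFinset u ∩ G.neighborFinset v).card = 2 := by
  rw [Finset.card_eq_two]; exact ⟨a, b, hab, by ext z; simpa using h z⟩

theorem adj_iff_not_adj_of_existsUnique_common {V : Type*} {G : SimpleGraph V} {u v a b : V} (hab : a ≠ b)
    (hv : ∀ z, G.Adj v z ↔ z = a ∨ z = b) (h : ∃ p, ∀ z, G.Adj u z ∧ G.Adj v z ↔ z = p) :
    G.Adj u a ↔ ¬ G.Adj u b := by
  obtain ⟨p, hp⟩ := h
  constructor
  · intro ha hb
    exact hab (((hp a).1 ⟨ha, (hv a).2 (.inl rfl)⟩).trans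
      ((hp b).1 ⟨hb, (hv b).2 (.inr rfl)⟩).symm)
  · intro hb
    obtain ⟨h1, h2⟩ := (hp p).2 rfl
    rcases (hv p).1 h2 with rfl | rfl
    exacts [h1, (hb h1).elim]

theorem exists_adj_ne_of_degree_eq_two {V : Type*} [Fintype V] {G : SimpleGraph V}
    [DecidableRel G.Adj] {u : V} (h : G.degree u = 2) (a : V) :
    ∃ b, b ≠ a ∧ G.Adj u b := by
  have : 1 < (G.neighborFinset u).card := by rw [card_neighborFinset_eq_degree, h]; norm_num
  obtain ⟨b, hb, hne⟩ := Finset.exists_mem_ne this a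
  exact ⟨b, hne, by simpa using hb⟩

theorem degree_eq_of_dominating {w : V} (hw : ∀ v, v ≠ w → G.Adj w v) :
    G.degree w + 1 = Fintype.card V := by
  have : G.neighborFinset w = Finset.univ.erase w := by
    ext v
    simp only [mem_neighborFinset, Finset.mem_erase, Finset.mem_univ, and_true]
    exact ⟨fun h => h.ne', hw v⟩
  rw [← card_neighborFinset_eq_degree, this, Finset.card_erase_of_mem (Finset.mem_univ w),
    Finset.card_univ]
  have : 0 < Fintype.card V := Fintype.card_pos_iff.2 ⟨w⟩
  omega

namespace FriendshipLike

/-- If some vertex is adjacent to all others, then all other vertices have degree two. -/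
theorem degree_eq_two_of_dominating (hG : G.FriendshipLike k) {w : V}
    (hw : ∀ v, v ≠ w → G.Adj w v) {v : V} (hv : v ≠ w) : G.degree v = 2 := by
  have hdw := degree_eq_of_dominating hw
  rw [hG.card_eq] at hdw
  have hcard : (Finset.univ.erase w).card = 2 * k := by
    rw [Finset.card_erase_of_mem (Finset.mem_univ w), Finset.card_univ, hG.card_eq]; rfl
  have hsum : ∑ v ∈ Finset.univ.erase w, G.degree v = 4 * k := by
    have : G.degree w + _ = _ :=
      Finset.add_sum_erase Finset.univ (fun v => G.degree v) (Finset.mem_univ w)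
    rw [hG.sum_degree] at this
    omega
  have hpos : ∀ v, v ≠ w → 1 ≤ G.degree v := fun v hv =>
    (G.degree_pos_iff_exists_adj v).2 ⟨w, (hw v hv).symm⟩
  by_cases hall : ∀ v, v ≠ w → 2 ≤ G.degree v
  · have h2 : ∑ v ∈ Finset.univ.erase w, 2 = ∑ v ∈ Finset.univ.erase w, G.degree v := by
      rw [hsum, Finset.sum_const, hcard, smul_eq_mul]; ring
    have := (Finset.sum_eq_sum_iff_of_le fun v hv => hall v (Finset.ne_of_mem_erase hv)).1 h2 v
      (by simpa using hv)
    exact this.symm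
  · exfalso
    push Not at hall
    obtain ⟨p, hpw, hp⟩ := hall
    have hp1 : G.degree p = 1 := by have := hpos p hpw; omega
    have hNp := adj_iff_of_degree_eq_one hp1 (hw p hpw).symm
    -- Two leaves would share the neighbour `w`, and `common_le` would read `4 ≤ 2`.
    have hge : ∀ v, v ≠ w → v ≠ p → 2 ≤ G.degree v := by
      intro v hvw hvp
      by_contra! hlt
      have hv1 : G.degree v = 1 := by have := hpos v hvw; omega
      have hNv := adj_iff_of_degree_eq_one hv1 (hw v hvw).symm
      have h1 := card_common_eq_one (G := G) (u := v) (v := p) (a := w)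
        fun z => by rw [hNv, hNp, and_self]
      have := hG.common_le v p hvp
      omega
    set T := (Finset.univ.erase w).erase p with hT
    have hpm : p ∈ Finset.univ.erase w := by simpa using hpw
    have hcT : T.card + 1 = 2 * k := by
      rw [hT, Finset.card_erase_of_mem hpm, hcard]
      have : 0 < 2 * k := hcard ▸ Finset.card_pos.2 ⟨p, hpm⟩
      omega
    have hsT : ∑ v ∈ T, G.degree v + 1 = 4 * k := by
      have : G.degree p + ∑ v ∈ T, G.degree v = _ :=
        Finset.add_sum_erase _ (fun v => G.degree v) hpm
      rw [hsum, hp1] at this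
      omega
    have hmT : ∀ v, v ∈ T ↔ v ≠ p ∧ v ≠ w := by simp [hT]
    -- The `2k - 1` vertices of `T` have degrees at least two with sum `4k - 1`: one vertex `z` has
    -- degree three, the others two.
    have hlt : ∑ v ∈ T, 2 < ∑ v ∈ T, G.degree v := by
      rw [Finset.sum_const, smul_eq_mul]; omega
    obtain ⟨z, hz, hz2⟩ := Finset.exists_lt_of_sum_lt hlt
    have hzw := (hmT z).1 hz
    have hsz : G.degree z + _ = _ := Finset.add_sum_erase _ (fun v => G.degree v) hz
    have hcz := Finset.card_erase_of_mem hz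
    have htwo : ∀ q, q ∈ T.erase z → G.degree q = 2 := by
      intro q hq
      have hsq : G.degree q + _ = _ := Finset.add_sum_erase _ (fun v => G.degree v) hq
      have hcq := Finset.card_erase_of_mem hq
      have hle : ∑ v ∈ (T.erase z).erase q, 2 ≤ ∑ v ∈ (T.erase z).erase q, G.degree v :=
        Finset.sum_le_sum fun v hv => by
          have := (hmT v).1 (Finset.mem_of_mem_erase (Finset.mem_of_mem_erase hv))
          exact hge v this.2 this.1
      rw [Finset.sum_const, smul_eq_mul] at hle
      have h1 := (hmT q).1 (Finset.mem_of_mem_erase hq)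
      have h2 := hge q h1.2 h1.1
      have h3 : 0 < (T.erase z).card := Finset.card_pos.2 ⟨q, hq⟩
      omega
    -- Two neighbours of `z` other than `w` both have neighbourhood `{w, z}`, and `common_le` would
    -- read `6 ≤ 4`.
    have hcN : 1 < ((G.neighborFinset z).erase w).card := by
      rw [Finset.card_erase_of_mem (by simpa using (hw z hzw.2).symm),
        card_neighborFinset_eq_degree]
      omega
    obtain ⟨a, ha, b, hb, hab⟩ := Finset.one_lt_card.1 hcN
    have hstep : ∀ a, a ∈ (G.neighborFinset z).erase w →
        G.degree a = 2 ∧ ∀ y, G.Adj a y ↔ y = w ∨ y = z := by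
      intro a ha
      simp only [Finset.mem_erase, mem_neighborFinset] at ha
      have hap : a ≠ p := by
        rintro rfl
        exact hzw.2 ((hNp z).1 ha.2.symm)
      have had := htwo a (by simp [hT, ha.2.ne', hap, ha.1])
      exact ⟨had, adj_iff_of_degree_eq_two had (hw a ha.1).symm ha.2.symm hzw.2.symm⟩
    obtain ⟨hda, hNa⟩ := hstep a ha
    obtain ⟨hdb, hNb⟩ := hstep b hb
    have h2 := card_common_eq_two (G := G) (u := a) (v := b) hzw.2.symm
      fun y => by rw [hNa, hNb, and_self]
    have := hG.common_le a b hab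
    omega

variable (hG : G.FriendshipLike k) (hdom : ∀ w, ∃ v, v ≠ w ∧ ¬ G.Adj w v)
include hG hdom

/-- The only neighbour of a leaf would be dominating, since every vertex is within distance two of
the leaf. -/
theorem two_le_degree (v : V) : 2 ≤ G.degree v := by
  by_contra! hlt
  obtain ⟨u, huv, hu⟩ := hdom v
  obtain ⟨w, hvw, -⟩ := hG.exists_common v u huv.symm hu
  have h1 : G.degree v = 1 := by
    have := (G.degree_pos_iff_exists_adj v).2 ⟨w, hvw⟩
    omega
  have hN := adj_iff_of_degree_eq_one h1 hvw
  obtain ⟨x, hxw, hx⟩ := hdom w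
  have hxv : v ≠ x := by rintro rfl; exact hx hvw.symm
  obtain ⟨y, hy1, hy2⟩ := hG.exists_common v x hxv fun h => hxw ((hN x).1 h)
  rw [hN] at hy1
  exact hx (hy1 ▸ hy2)

/-- The degree sum `6k` is three less than three times the order, and a vertex falls short of degree
three by at most one. -/
theorem three_le_card_degree_eq_two :
    3 ≤ (Finset.univ.filter fun v => G.degree v = 2).card := by
  have h1 : ∑ v, 3 ≤ ∑ v, (G.degree v + if G.degree v = 2 then 1 else 0) :=
    Finset.sum_le_sum fun v _ => by
      have := hG.two_le_degree hdom v
      split_ifs <;> omega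
  rw [Finset.sum_add_distrib, hG.sum_degree, Finset.sum_const, Finset.card_univ, hG.card_eq,
    ← Finset.card_filter, smul_eq_mul] at h1
  omega

theorem three_le_degree {v : V} (hv : G.degree v ≠ 2) : 3 ≤ G.degree v := by
  have := hG.two_le_degree hdom v
  omega

/-- With `m` vertices of degree two, the excesses of the other degrees over three are nonnegative
and sum to `m - 3`. -/
theorem degree_add_degree_le {v z : V} (hvz : v ≠ z) (hv : G.degree v ≠ 2) (hz : G.degree z ≠ 2) :
    G.degree v + G.degree z ≤ (Finset.univ.filter fun v => G.degree v = 2).card + 3 := by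
  have h1 : ∑ y ∈ Finset.univ \ {v, z}, 3 ≤
      ∑ y ∈ Finset.univ \ {v, z}, (G.degree y + if G.degree y = 2 then 1 else 0) :=
    Finset.sum_le_sum fun v _ => by
      have := hG.two_le_degree hdom v
      split_ifs <;> omega
  have h2 := Finset.sum_sdiff (Finset.subset_univ {v, z})
    (f := fun y => G.degree y + if G.degree y = 2 then 1 else 0)
  rw [Finset.sum_pair hvz, if_neg hv, if_neg hz, Finset.sum_add_distrib (s := Finset.univ),
    hG.sum_degree, ← Finset.card_filter] at h2
  rw [Finset.sum_const, Finset.card_sdiff_of_subset (Finset.subset_univ _), Finset.card_univ,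
    hG.card_eq, Finset.card_pair hvz, smul_eq_mul] at h1
  omega

/-- For degree two, one common neighbour means coinciding plane vectors and none means squared
distance two. Add a third vertex of degree two: by `twins` one coincidence among the three forces
all, and no coincidence contradicts `not_equilateral`. -/
theorem card_common_eq_one_of_degree_eq_two {u v : V} (huv : u ≠ v) (hu : G.degree u = 2)
    (hv : G.degree v = 2) : (G.neighborFinset u ∩ G.neighborFinset v).card = 1 := by
  have hle := hG.common_le u v huv
  by_contra hne
  have h0 : (G.neighborFinset u ∩ G.neighborFinset v).card = 0 := by omega
  have hlt : ({u, v} : Finset V).card < (Finset.univ.filter fun v => G.degree v = 2).card := by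
    rw [Finset.card_pair huv]
    exact hG.three_le_card_degree_eq_two hdom
  obtain ⟨w, hw, hwuv⟩ := Finset.exists_mem_notMem_of_card_lt_card hlt
  simp only [Finset.mem_filter, Finset.mem_univ, true_and] at hw
  simp only [Finset.mem_insert, Finset.mem_singleton, not_or] at hwuv
  have hle1 := hG.common_le u w (Ne.symm hwuv.1)
  have hle2 := hG.common_le v w (Ne.symm hwuv.2)
  have t1 := hG.twins u w v 2 (Ne.symm hwuv.1) huv hwuv.2 (by norm_num) hu hw hv
  have t2 := hG.twins v w u 2 (Ne.symm hwuv.2) huv.symm hwuv.1 (by norm_num) hv hw hu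
  rw [Finset.inter_comm (G.neighborFinset v) (G.neighborFinset u)] at t2
  have t3 := hG.not_equilateral u v w 2 huv (Ne.symm hwuv.1) (Ne.symm hwuv.2) (by norm_num) hu hv hw
  omega

theorem existsUnique_common {u v : V} (huv : u ≠ v) (hu : G.degree u = 2)
    (hv : G.degree v = 2) : ∃ a, ∀ z, G.Adj u z ∧ G.Adj v z ↔ z = a := by
  obtain ⟨a, ha⟩ := Finset.card_eq_one.1 (hG.card_common_eq_one_of_degree_eq_two hdom huv hu hv)
  refine ⟨a, fun z => ?_⟩
  have := congrArg (z ∈ ·) ha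
  simpa using this

/-- If adjacent, `u` and `v` have a common neighbour and no further ones; diameter two makes it
dominating. -/
theorem not_adj_of_degree_eq_two {u v : V} (hu : G.degree u = 2) (hv : G.degree v = 2) :
    ¬ G.Adj u v := by
  intro huv
  obtain ⟨w, hw⟩ := hG.existsUnique_common hdom huv.ne hu hv
  obtain ⟨huw, hvw⟩ := (hw w).2 rfl
  have hNu := adj_iff_of_degree_eq_two hu huv huw hvw.ne
  have hNv := adj_iff_of_degree_eq_two hv huv.symm hvw huw.ne
  obtain ⟨x, hxw, hx⟩ := hdom w
  have hxu : u ≠ x := by rintro rfl; exact hx huw.symm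
  have hxv : v ≠ x := by rintro rfl; exact hx hvw.symm
  obtain ⟨y, hy1, hy2⟩ := hG.exists_common u x hxu (by
    rw [hNu]; rintro (h | h); exacts [hxv h.symm, hxw h])
  rcases (hNu y).1 hy1 with rfl | rfl
  · rcases (hNv x).1 hy2 with h | h
    exacts [hxu h.symm, hxw h]
  · exact hx hy2

omit hdom in
-- The vertices `a` and `b` share `p` and `x`, so they are twins of degree three, but `a` and `x`
-- share nothing, against `twins`.
theorem not_common_of_degree_eq_three {a b p q r x : V} (ha : G.degree a = 3) (hb : G.degree b = 3)
    (hx : G.degree x = 3) (hab : a ≠ b) (hpq : p ≠ q) (hpr : p ≠ r) (hqr : q ≠ r)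
    (hxp : x ≠ p) (hxq : x ≠ q) (hxr : x ≠ r)
    (hap : G.Adj a p) (haq : G.Adj a q) (hbp : G.Adj b p) (hbr : G.Adj b r)
    (hnp : ¬ G.Adj x p) (hnq : ¬ G.Adj x q) (hax : G.Adj a x) (hbx : G.Adj b x) : False := by
  have hNa := adj_iff_of_degree_eq_three ha hap haq hax hpq hxp.symm hxq.symm
  have hNb := adj_iff_of_degree_eq_three hb hbp hbr hbx hpr hxp.symm hxr.symm
  have h1 := card_common_eq_two (G := G) (u := a) (v := b) hxp.symm (by grind)
  have h2 := card_common_eq_zero (G := G) (u := a) (v := x) (by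
    intro z hz hxz
    rcases (hNa z).1 hz with rfl | rfl | rfl
    exacts [hnp hxz, hnq hxz, hxz.ne rfl])
  have := hG.twins a b x 3 hab hax.ne hbx.ne le_rfl ha hb hx
  omega

/-- There are only three vertices of degree two, so all other degrees are three. By diameter two, a
vertex outside the hexagon is adjacent to at least two of `a`, `b`, `c`, which
`not_common_of_degree_eq_three` excludes. -/
theorem false_of_triangle {u₁ u₂ u₃ a b c : V} (h₁ : G.degree u₁ = 2) (h₂ : G.degree u₂ = 2)
    (h₃ : G.degree u₃ = 2) (h₁₂ : u₁ ≠ u₂) (h₁₃ : u₁ ≠ u₃) (h₂₃ : u₂ ≠ u₃)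
    (hab : a ≠ b) (hac : a ≠ c) (hbc : b ≠ c)
    (h1a : G.Adj u₁ a) (h1b : G.Adj u₁ b) (h2b : G.Adj u₂ b) (h2c : G.Adj u₂ c)
    (h3a : G.Adj u₃ a) (h3c : G.Adj u₃ c) : False := by
  have hN1 := adj_iff_of_degree_eq_two h₁ h1a h1b hab
  have hN2 := adj_iff_of_degree_eq_two h₂ h2b h2c hbc
  have hN3 := adj_iff_of_degree_eq_two h₃ h3a h3c hac
  have hS : (Finset.univ.filter fun v => G.degree v = 2) = {u₁, u₂, u₃} := by
    ext u
    simp only [Finset.mem_filter, Finset.mem_univ, true_and, Finset.mem_insert,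
      Finset.mem_singleton]
    refine ⟨fun hu => ?_, by rintro (rfl | rfl | rfl) <;> assumption⟩
    -- A fourth such vertex would be adjacent to exactly one of each two of `a`, `b`, `c`, which
    -- parity forbids.
    by_contra! hne
    have e1 := adj_iff_not_adj_of_existsUnique_common hab hN1
      (hG.existsUnique_common hdom hne.1 hu h₁)
    have e2 := adj_iff_not_adj_of_existsUnique_common hbc hN2
      (hG.existsUnique_common hdom hne.2.1 hu h₂)
    have e3 := adj_iff_not_adj_of_existsUnique_common hac hN3
      (hG.existsUnique_common hdom hne.2.2 hu h₃)
    rw [e1, e2, not_not] at e3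
    exact iff_not_self e3
  have hne2 : ∀ v, v ≠ u₁ → v ≠ u₂ → v ≠ u₃ → G.degree v ≠ 2 := by
    intro v e1 e2 e3 hv
    have : v ∈ (Finset.univ.filter fun v => G.degree v = 2) := by simpa using hv
    rw [hS] at this
    simp [e1, e2, e3] at this
  have hcS : (Finset.univ.filter fun v => G.degree v = 2).card = 3 := by
    rw [hS, Finset.card_eq_three]; exact ⟨_, _, _, h₁₂, h₁₃, h₂₃, rfl⟩
  have hind : ∀ u v, G.Adj u v → G.degree u = 2 → G.degree v ≠ 2 := fun u v huv hu hv =>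
    hG.not_adj_of_degree_eq_two hdom hu hv huv
  have ha := hind _ _ h1a h₁
  have hb := hind _ _ h1b h₁
  have hc := hind _ _ h2c h₂
  have hd3 : ∀ v z, v ≠ z → G.degree v ≠ 2 → G.degree z ≠ 2 → G.degree v = 3 := by
    intro v z hvz hv hz
    have e1 := hG.degree_add_degree_le hdom hvz hv hz
    have e2 := hG.three_le_degree hdom hv
    have e3 := hG.three_le_degree hdom hz
    omega
  have ha3 := hd3 a b hab ha hb
  have hb3 := hd3 b c hbc hb hc
  have hc3 := hd3 c a hac.symm hc ha
  -- The order `2k + 1` is odd, so it is not six.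
  have hlt : ∃ x, x ∉ ({u₁, u₂, u₃, a, b, c} : Finset V) := by
    by_contra! hall
    have e2 : ({u₁, u₂, u₃, a, b, c} : Finset V).card = 6 := by
      have n1 : u₁ ≠ a := by rintro rfl; exact ha h₁
      have n2 : u₁ ≠ b := by rintro rfl; exact hb h₁
      have n3 : u₁ ≠ c := by rintro rfl; exact hc h₁
      have n4 : u₂ ≠ a := by rintro rfl; exact ha h₂
      have n5 : u₂ ≠ b := by rintro rfl; exact hb h₂
      have n6 : u₂ ≠ c := by rintro rfl; exact hc h₂
      have n7 : u₃ ≠ a := by rintro rfl; exact ha h₃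
      have n8 : u₃ ≠ b := by rintro rfl; exact hb h₃
      have n9 : u₃ ≠ c := by rintro rfl; exact hc h₃
      simp [h₁₂, h₁₃, h₂₃, hab, hac, hbc, n1, n2, n3, n4, n5, n6, n7, n8, n9]
    have e1 : ({u₁, u₂, u₃, a, b, c} : Finset V) = Finset.univ := by
      ext x; simpa using hall x
    rw [e1, Finset.card_univ, hG.card_eq] at e2
    omega
  obtain ⟨x, hx⟩ := hlt
  simp only [Finset.mem_insert, Finset.mem_singleton, not_or] at hx
  obtain ⟨x1, x2, x3, xa, xb, xc⟩ := hx
  have hx3 := hd3 x a xa (hne2 x x1 x2 x3) ha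
  have n1 : ¬ G.Adj x u₁ := fun h => by
    rcases (hN1 x).1 h.symm with h | h
    exacts [xa h, xb h]
  have n2 : ¬ G.Adj x u₂ := fun h => by
    rcases (hN2 x).1 h.symm with h | h
    exacts [xb h, xc h]
  have n3 : ¬ G.Adj x u₃ := fun h => by
    rcases (hN3 x).1 h.symm with h | h
    exacts [xa h, xc h]
  have k1 : G.Adj a x ∨ G.Adj b x := by
    obtain ⟨y, hy1, hy2⟩ := hG.exists_common u₁ x (Ne.symm x1) fun h => n1 h.symm
    rcases (hN1 y).1 hy1 with rfl | rfl
    exacts [.inl hy2, .inr hy2]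
  have k2 : G.Adj b x ∨ G.Adj c x := by
    obtain ⟨y, hy1, hy2⟩ := hG.exists_common u₂ x (Ne.symm x2) fun h => n2 h.symm
    rcases (hN2 y).1 hy1 with rfl | rfl
    exacts [.inl hy2, .inr hy2]
  have k3 : G.Adj a x ∨ G.Adj c x := by
    obtain ⟨y, hy1, hy2⟩ := hG.exists_common u₃ x (Ne.symm x3) fun h => n3 h.symm
    rcases (hN3 y).1 hy1 with rfl | rfl
    exacts [.inl hy2, .inr hy2]
  have c1 : G.Adj a x → G.Adj b x → False := hG.not_common_of_degree_eq_three ha3 hb3 hx3 hab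
    h₁₃ h₁₂ h₂₃.symm x1 x3 x2 h1a.symm h3a.symm h1b.symm h2b.symm n1 n3
  have c2 : G.Adj b x → G.Adj c x → False := hG.not_common_of_degree_eq_three hb3 hc3 hx3 hbc
    h₁₂.symm h₂₃ h₁₃ x2 x1 x3 h2b.symm h1b.symm h2c.symm h3c.symm n2 n1
  have c3 : G.Adj a x → G.Adj c x → False := hG.not_common_of_degree_eq_three ha3 hc3 hx3 hac
    h₁₃.symm h₂₃.symm h₁₂ x3 x1 x2 h3a.symm h1a.symm h3c.symm h2c.symm n3 n1
  rcases k1 with k | k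
  · exact k2.elim (c1 k) (c3 k)
  · exact k3.elim (fun h => c1 h k) (c2 k)

/-- The degree bound is tight: the neighbours of `w` are exactly the vertices of degree two, and
their second neighbours have degree three. These second neighbours are distinct and, by diameter
two, pairwise adjacent, so there are just three. Then `w` and two of them have degree three and
pairwise one common neighbour, against `not_equilateral`. -/
theorem false_of_star {w : V} (hw : ∀ u, G.degree u = 2 → G.Adj u w) : False := by
  set S := Finset.univ.filter fun v => G.degree v = 2 with hS
  have hmem : ∀ u, u ∈ S ↔ G.degree u = 2 := by simp [hS]
  have hm : 3 ≤ S.card := hG.three_le_card_degree_eq_two hdom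
  have hind : ∀ u v, G.Adj u v → G.degree u = 2 → G.degree v ≠ 2 := fun u v huv hu hv =>
    hG.not_adj_of_degree_eq_two hdom hu hv huv
  obtain ⟨u₁, hu1, u₂, hu2, u₃, hu3, h₁₂, h₁₃, h₂₃⟩ := Finset.two_lt_card.1 hm
  rw [hmem] at hu1 hu2 hu3
  have hw2 := hind _ _ (hw u₁ hu1) hu1
  have hsub : S ⊆ G.neighborFinset w := fun u hu => by
    simpa using (hw u ((hmem u).1 hu)).symm
  have hSle : S.card ≤ G.degree w := by
    rw [← card_neighborFinset_eq_degree]; exact Finset.card_le_card hsub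
  have key : ∀ u, G.degree u = 2 → ∃ v, (∀ z, G.Adj u z ↔ z = w ∨ z = v) ∧ v ≠ w ∧
      G.degree v = 3 ∧ G.degree w = S.card ∧ ¬ G.Adj w v := by
    intro u hu
    obtain ⟨v, hvw, huv⟩ := exists_adj_ne_of_degree_eq_two hu w
    have hv2 := hind u v huv hu
    have e1 := hG.degree_add_degree_le hdom hvw hv2 hw2
    rw [← hS] at e1
    have e2 := hG.three_le_degree hdom hv2
    have e3 : G.degree w = S.card := by omega
    refine ⟨v, adj_iff_of_degree_eq_two hu (hw u hu) huv hvw.symm, hvw, by omega, e3, fun h => ?_⟩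
    have : S = G.neighborFinset w := Finset.eq_of_subset_of_card_le hsub (by
      rw [card_neighborFinset_eq_degree, e3])
    have hvS : v ∈ S := by rw [this]; simpa using h
    exact hv2 ((hmem v).1 hvS)
  have hne : ∀ u u' v v', G.degree u = 2 → G.degree u' = 2 → u ≠ u' → v ≠ w →
      (∀ z, G.Adj u z ↔ z = w ∨ z = v) → (∀ z, G.Adj u' z ↔ z = w ∨ z = v') → v ≠ v' := by
    rintro u u' v _ hu hu' huu hvw h h' rfl
    obtain ⟨a, ha⟩ := hG.existsUnique_common hdom huu hu hu'
    have e1 := (ha w).1 ⟨(h w).2 (.inl rfl), (h' w).2 (.inl rfl)⟩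
    have e2 := (ha v).1 ⟨(h v).2 (.inr rfl), (h' v).2 (.inr rfl)⟩
    exact hvw (e2.trans e1.symm)
  have hadj : ∀ u v v', v ≠ v' → ¬ G.Adj w v → v ≠ w → G.degree v ≠ 2 → G.degree u = 2 →
      (∀ z, G.Adj u z ↔ z = w ∨ z = v') → G.Adj v v' := by
    intro u v v' hvv hwv hvw hv hu h
    have huv : u ≠ v := by rintro rfl; exact hv hu
    obtain ⟨y, hy1, hy2⟩ := hG.exists_common u v huv (by
      rw [h]; rintro (e | e); exacts [hvw e, hvv e])
    rcases (h y).1 hy1 with rfl | rfl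
    exacts [(hwv hy2).elim, hy2.symm]
  obtain ⟨v₁, hN1, hv1w, hd1, hdw, hnw1⟩ := key u₁ hu1
  obtain ⟨v₂, hN2, hv2w, hd2, -, hnw2⟩ := key u₂ hu2
  obtain ⟨v₃, hN3, hv3w, hd3, -, hnw3⟩ := key u₃ hu3
  have v12 := hne _ _ _ _ hu1 hu2 h₁₂ hv1w hN1 hN2
  have v13 := hne _ _ _ _ hu1 hu3 h₁₃ hv1w hN1 hN3
  have v23 := hne _ _ _ _ hu2 hu3 h₂₃ hv2w hN2 hN3
  have a12 := hadj u₂ v₁ v₂ v12 hnw1 hv1w (by omega) hu2 hN2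
  have a13 := hadj u₃ v₁ v₃ v13 hnw1 hv1w (by omega) hu3 hN3
  have a23 := hadj u₃ v₂ v₃ v23 hnw2 hv2w (by omega) hu3 hN3
  have n12 : u₁ ≠ v₂ := by rintro rfl; omega
  have n13 : u₁ ≠ v₃ := by rintro rfl; omega
  have n21 : u₂ ≠ v₁ := by rintro rfl; omega
  have n23 : u₂ ≠ v₃ := by rintro rfl; omega
  have hV1 := adj_iff_of_degree_eq_three hd1 ((hN1 v₁).2 (.inr rfl)).symm a12 a13 n12 n13 v23
  have hV2 := adj_iff_of_degree_eq_three hd2 ((hN2 v₂).2 (.inr rfl)).symm a12.symm a23 n21 n23 v13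
  have hS3 : ∀ u, G.degree u = 2 → u = u₁ ∨ u = u₂ ∨ u = u₃ := by
    intro u hu
    by_contra! hcon
    obtain ⟨v, hN, hvw, hd, -, hnw⟩ := key u hu
    have e1 := hne _ _ _ _ hu hu1 hcon.1 hvw hN hN1
    have e2 := hne _ _ _ _ hu hu2 hcon.2.1 hvw hN hN2
    have e3 := hne _ _ _ _ hu hu3 hcon.2.2 hvw hN hN3
    have := hadj u v₁ v e1.symm hnw1 hv1w (by omega) hu hN
    rcases (hV1 v).1 this with rfl | rfl | rfl
    exacts [by omega, e2 rfl, e3 rfl]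
  have hSeq : S = {u₁, u₂, u₃} := by
    ext u
    rw [hmem]
    simp only [Finset.mem_insert, Finset.mem_singleton]
    exact ⟨hS3 u, by rintro (rfl | rfl | rfl) <;> assumption⟩
  have hdw3 : G.degree w = 3 := by
    rw [hdw, hSeq, Finset.card_eq_three]; exact ⟨_, _, _, h₁₂, h₁₃, h₂₃, rfl⟩
  have hW := adj_iff_of_degree_eq_three hdw3 (hw _ hu1).symm (hw _ hu2).symm (hw _ hu3).symm
    h₁₂ h₁₃ h₂₃
  have n11 : ∀ u v, G.degree u = 2 → G.degree v = 3 → u ≠ v := by rintro u v h h' rfl; omega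
  have m31 := n11 _ _ hu3 hd1
  have m32 := n11 _ _ hu3 hd2
  have m22 := n11 _ _ hu2 hd2
  have c1 := card_common_eq_one (G := G) (u := w) (v := v₁) (a := u₁) (by
    intro z; rw [hW, hV1]; grind)
  have c2 := card_common_eq_one (G := G) (u := w) (v := v₂) (a := u₂) (by
    intro z; rw [hW, hV2]; grind)
  have c3 := card_common_eq_one (G := G) (u := v₁) (v := v₂) (a := v₃) (by
    intro z; rw [hV1, hV2]; grind)
  exact hG.not_equilateral w v₁ v₂ 3 hv1w.symm hv2w.symm v12 le_rfl hdw3 hd1 hd2 (by omega)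
    (by omega) (by omega)

omit hdom in
/-- Some vertex is adjacent to all others. -/
theorem exists_dominating : ∃ w, ∀ v, v ≠ w → G.Adj w v := by
  by_contra! hdom
  obtain ⟨u₁, hu1, u₂, hu2, h₁₂⟩ := Finset.one_lt_card.1
    ((hG.three_le_card_degree_eq_two hdom).trans' (by norm_num))
  simp only [Finset.mem_filter, Finset.mem_univ, true_and] at hu1 hu2
  obtain ⟨w, hw⟩ := hG.existsUnique_common hdom h₁₂ hu1 hu2
  obtain ⟨a1, a2⟩ := (hw w).2 rfl
  obtain ⟨v₁, hv1, b1⟩ := exists_adj_ne_of_degree_eq_two hu1 w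
  obtain ⟨v₂, hv2, b2⟩ := exists_adj_ne_of_degree_eq_two hu2 w
  have hN1 := adj_iff_of_degree_eq_two hu1 a1 b1 hv1.symm
  have hN2 := adj_iff_of_degree_eq_two hu2 a2 b2 hv2.symm
  refine hG.false_of_star hdom (w := w) fun u₃ hu3 => ?_
  by_contra h3
  have h₁₃ : u₁ ≠ u₃ := by rintro rfl; exact h3 a1
  have h₂₃ : u₂ ≠ u₃ := by rintro rfl; exact h3 a2
  obtain ⟨p, hp⟩ := hG.existsUnique_common hdom h₁₃ hu1 hu3
  obtain ⟨q, hq⟩ := hG.existsUnique_common hdom h₂₃ hu2 hu3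
  obtain ⟨p1, p3⟩ := (hp p).2 rfl
  obtain ⟨q2, q3⟩ := (hq q).2 rfl
  have hpv : p = v₁ := ((hN1 p).1 p1).resolve_left (by rintro rfl; exact h3 p3)
  have hqv : q = v₂ := ((hN2 q).1 q2).resolve_left (by rintro rfl; exact h3 q3)
  subst hpv hqv
  have hpq : p ≠ q := by
    rintro rfl
    exact hv1 ((hw p).1 ⟨p1, q2⟩)
  exact hG.false_of_triangle hdom hu1 hu2 hu3 h₁₂ h₁₃ h₂₃ hv1 hpq hv2.symm b1 a1 a2 b2 p3 q3

end FriendshipLike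

end

end SimpleGraph

/-! ### Recognising the friendship graph -/

namespace SimpleGraph

section

variable {V : Type*} [Fintype V] [DecidableEq V] {G : SimpleGraph V} [DecidableRel G.Adj] {k : ℕ}

/-- A graph in which one vertex is adjacent to all others and all others have degree two is a
friendship graph. -/
theorem nonempty_iso_friendshipGraph (hcard : Fintype.card V = 2 * k + 1) {w : V}
    (hw : ∀ v, v ≠ w → G.Adj w v) (hdeg : ∀ v, v ≠ w → G.degree v = 2) :
    Nonempty (G ≃g friendshipGraph k) := by
  have hpart : ∀ v, ∃ p, v ≠ w → p ≠ w ∧ p ≠ v ∧ ∀ z, G.Adj v z ↔ z = w ∨ z = p := by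
    intro v
    by_cases hv : v = w
    · exact ⟨v, fun h => (h hv).elim⟩
    obtain ⟨p, hpw, hp⟩ := exists_adj_ne_of_degree_eq_two (hdeg v hv) w
    exact ⟨p, fun _ => ⟨hpw, hp.ne', adj_iff_of_degree_eq_two (hdeg v hv) (hw v hv).symm hp
      hpw.symm⟩⟩
  choose p hp using hpart
  have hpw : ∀ v, v ≠ w → p v ≠ w := fun v hv => (hp v hv).1
  have hpv : ∀ v, v ≠ w → p v ≠ v := fun v hv => (hp v hv).2.1
  have hadj : ∀ v, v ≠ w → ∀ z, G.Adj v z ↔ z = w ∨ z = p v := fun v hv => (hp v hv).2.2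
  have hpp : ∀ v, v ≠ w → p (p v) = v := by
    intro v hv
    have h1 : G.Adj (p v) v := ((hadj v hv _).2 (.inr rfl)).symm
    exact (((hadj _ (hpw v hv) v).1 h1).resolve_left hv).symm
  -- An arbitrary enumeration, used to pick one vertex from each pair `{v, p v}`.
  let r := Fintype.equivFin V
  let A := {v : V // v ≠ w ∧ r v < r (p v)}
  let f : Option (A × Bool) → V := fun u =>
    u.elim w fun q => bif q.2 then p q.1 else q.1
  have hf : Function.Bijective f := by
    constructor
    · rintro (_ | ⟨⟨a, ha, har⟩, b⟩) (_ | ⟨⟨a', ha', har'⟩, b'⟩) h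
      · rfl
      · exfalso
        cases b'
        exacts [ha' h.symm, hpw _ ha' h.symm]
      · exfalso
        cases b
        exacts [ha h, hpw _ ha h]
      · cases b <;> cases b' <;> simp only [f, Option.elim, cond_true, cond_false] at h
        · subst h; rfl
        · subst h
          rw [hpp _ ha'] at har
          exact (lt_asymm har har').elim
        · subst h
          rw [hpp _ ha] at har'
          exact (lt_asymm har har').elim
        · have := congrArg p h
          rw [hpp _ ha, hpp _ ha'] at this
          subst this; rfl
    · intro v
      by_cases hv : v = w
      · exact ⟨none, hv.symm⟩
      rcases lt_trichotomy (r v) (r (p v)) with h | h | h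
      · exact ⟨some (⟨v, hv, h⟩, false), rfl⟩
      · exact (hpv v hv (r.injective h).symm).elim
      · refine ⟨some (⟨p v, hpw v hv, ?_⟩, true), hpp v hv⟩
        rwa [hpp v hv]
  have hA : Fintype.card A = k := by
    have := Fintype.card_of_bijective hf
    rw [Fintype.card_option, Fintype.card_prod, Fintype.card_bool] at this
    omega
  let e : Fin k ≃ A := (Fintype.equivFinOfCardEq hA).symm
  let g : Option (Fin k × Bool) ≃ V :=
    (Equiv.optionCongr (e.prodCongr (Equiv.refl Bool))).trans (Equiv.ofBijective f hf)
  have hg0 : g none = w := rfl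
  have hgne : ∀ q, g (some q) ≠ w := fun q h => by
    have := g.injective (h.trans hg0.symm)
    simp at this
  have hgflip : ∀ i b, p (g (some (i, b))) = g (some (i, !b)) := by
    intro i b
    cases b
    · rfl
    · exact hpp _ (e i).2.1
  refine ⟨(RelIso.symm ⟨g, ?_⟩ : G ≃g friendshipGraph k)⟩
  rintro (_ | u) (_ | v)
  · simp
  · exact iff_of_true (hw _ (hgne v)) (friendshipGraph_adj_none_some v)
  · exact iff_of_true (hw _ (hgne u)).symm (friendshipGraph_adj_none_some u).symm
  · rw [friendshipGraph_adj_some_some, hadj _ (hgne u), hgflip]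
    simp [hgne v]

end

/-! ### Plane geometry behind the `FriendshipLike` conditions -/

section

variable {W : Type*} [Fintype W] [DecidableEq W] {H : SimpleGraph W} {k : ℕ}

/-- The squared cross product is `s(2a - s) ≥ 2a - 1` by Lagrange's identity, but at most
`(5/4)(3a/2)` by a weighted Cauchy-Schwarz inequality; for `a > 8` these conflict. The weight 2 is
there because a repeated vector contributes its `y` twice. -/
theorem false_of_planar_twins {x y x' y' a s q : ℝ} (ha : 9 ≤ a) (hs : 1 ≤ s) (hsa : s ≤ a)
    (hq : q ≤ 5 / 4) (h : x ^ 2 + y ^ 2 = a) (h' : x' ^ 2 + y' ^ 2 = a)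
    (hxx : x * x' + y * y' = a - s) (hy : 2 * y ^ 2 + y' ^ 2 ≤ q) : False := by
  have h1 : (x * y' - y * x') ^ 2 = s * (2 * a - s) := by
    have : (x * y' - y * x') ^ 2 = (x ^ 2 + y ^ 2) * (x' ^ 2 + y' ^ 2) - (x * x' + y * y') ^ 2 := by
      ring
    rw [this, h, h', hxx]; ring
  have h2 : 2 * a - 1 ≤ s * (2 * a - s) := by nlinarith
  have h3 : (x * y' - y * x') ^ 2 ≤ (2 * y ^ 2 + y' ^ 2) * (x ^ 2 + x' ^ 2 / 2) := by
    nlinarith [sq_nonneg (x' * y' + 2 * x * y)]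
  have h4 : x ^ 2 + x' ^ 2 / 2 ≤ 3 / 2 * a := by nlinarith [sq_nonneg y, sq_nonneg y']
  have h5 : (2 * y ^ 2 + y' ^ 2) * (x ^ 2 + x' ^ 2 / 2) ≤ 5 / 4 * (3 / 2 * a) :=
    mul_le_mul (hy.trans hq) h4 (by positivity) (by norm_num)
  linarith

/-- The Gram determinant of three plane vectors vanishes, but here it is `3a - 2`. -/
theorem false_of_planar_equilateral {x₁ y₁ x₂ y₂ x₃ y₃ a : ℝ} (ha : 1 ≤ a)
    (h₁ : x₁ * x₁ + y₁ * y₁ = a) (h₂ : x₂ * x₂ + y₂ * y₂ = a) (h₃ : x₃ * x₃ + y₃ * y₃ = a)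
    (h₁₂ : x₁ * x₂ + y₁ * y₂ = a - 1) (h₁₃ : x₁ * x₃ + y₁ * y₃ = a - 1)
    (h₂₃ : x₂ * x₃ + y₂ * y₃ = a - 1) : False := by
  have h : a * a * a + 2 * ((a - 1) * (a - 1) * (a - 1)) - 3 * (a * ((a - 1) * (a - 1))) = 0 := by
    calc _ = (x₁ * x₁ + y₁ * y₁) * (x₂ * x₂ + y₂ * y₂) * (x₃ * x₃ + y₃ * y₃)
          + 2 * ((x₁ * x₂ + y₁ * y₂) * (x₁ * x₃ + y₁ * y₃) * (x₂ * x₃ + y₂ * y₃))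
          - (x₁ * x₁ + y₁ * y₁) * ((x₂ * x₃ + y₂ * y₃) * (x₂ * x₃ + y₂ * y₃))
          - (x₂ * x₂ + y₂ * y₂) * ((x₁ * x₃ + y₁ * y₃) * (x₁ * x₃ + y₁ * y₃))
          - (x₃ * x₃ + y₃ * y₃) * ((x₁ * x₂ + y₁ * y₂) * (x₁ * x₂ + y₁ * y₂)) := by
          rw [h₁, h₂, h₃, h₁₂, h₁₃, h₂₃]; ring
      _ = 0 := by ring
  have : a * a * a + 2 * ((a - 1) * (a - 1) * (a - 1)) - 3 * (a * ((a - 1) * (a - 1))) =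
      3 * a - 2 := by ring
  linarith

/-- In diameter two the diagonal of `M` is affine in the degrees, so the trace determines their sum.
-/
theorem sum_degree_of_distanceSpectrum_eq [DecidableRel H.Adj] (hH : H.Connected)
    (hd : ∀ u v, H.dist u v ≤ 2) (h : H.distanceSpectrum = (friendshipGraph k).distanceSpectrum) :
    ∑ v, H.degree v = 6 * k := by
  have h1 := trace_shiftedSquare_eq_of_distanceSpectrum_eq_friendshipGraph h
  have h2 : ∀ v, H.shiftedSquare v v = (8 * k + 3) - 3 * (H.degree v : ℝ) := by
    intro v
    rw [shiftedSquare_apply hH hd, Finset.inter_self, card_neighborFinset_eq_degree, if_pos rfl,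
      card_eq_of_distanceSpectrum_eq_friendshipGraph h]
    push_cast; ring
  rw [Matrix.trace] at h1
  simp only [Matrix.diag_apply, h2] at h1
  rw [Finset.sum_sub_distrib, ← Finset.mul_sum, Finset.sum_const, Finset.card_univ,
    card_eq_of_distanceSpectrum_eq_friendshipGraph h, nsmul_eq_mul] at h1
  push_cast at h1
  have h3 : ((∑ v, H.degree v : ℕ) : ℝ) = (6 * k : ℕ) := by
    push_cast
    linarith
  exact_mod_cast h3

theorem friendshipLike_of_distanceSpectrum_eq [DecidableRel H.Adj] (hk : 2 ≤ k)
    (hH : H.Connected) (hd : ∀ u v, H.dist u v ≤ 2)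
    (h : H.distanceSpectrum = (friendshipGraph k).distanceSpectrum) : H.FriendshipLike k := by
  have hcard := card_eq_of_distanceSpectrum_eq_friendshipGraph h
  have hk' : (2 : ℝ) ≤ k := by exact_mod_cast hk
  obtain ⟨x, y, hxy, hy⟩ := exists_gram_of_distanceSpectrum_eq_friendshipGraph (by omega) h
  have hself : ∀ u, x u ^ 2 + y u ^ 2 = 8 * (k : ℝ) + 3 - 3 * H.degree u := by
    intro u
    have := hxy u u
    rw [shiftedSquare_apply hH hd, Finset.inter_self, card_neighborFinset_eq_degree, if_pos rfl,
      hcard] at this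
    push_cast at this
    linarith
  have hne : ∀ u v, u ≠ v → x u * x v + y u * y v = 8 * (k : ℝ) + 4 - 2 * H.degree u -
      2 * H.degree v + (H.neighborFinset u ∩ H.neighborFinset v).card := by
    intro u v huv
    rw [← hxy, shiftedSquare_apply hH hd, if_neg huv, hcard]
    push_cast; ring
  refine ⟨hcard, sum_degree_of_distanceSpectrum_eq hH hd h, ?_, ?_, ?_, ?_⟩
  · intro u v huv hadj
    obtain ⟨p, hp⟩ := hH.exists_walk_length_eq_dist u v
    have hle := hd u v
    rw [← hp] at hle
    match p with
    | .nil => exact (huv rfl).elim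
    | .cons h1 .nil => exact (hadj h1).elim
    | .cons h1 (.cons h2 .nil) => exact ⟨_, h1, h2⟩
    | .cons _ (.cons _ (.cons _ q)) => simp at hle
  · intro u v huv
    have h1 := hself u
    have h2 := hself v
    have h3 := hne u v huv
    have h4 : 2 * ((H.neighborFinset u ∩ H.neighborFinset v).card : ℝ) + 2 ≤
        H.degree u + H.degree v := by
      nlinarith [sq_nonneg (x u - x v), sq_nonneg (y u - y v)]
    exact_mod_cast h4
  · intro u v w d huv huw hvw hd3 hu hv hw hc
    by_contra! hlt
    have h1 := hself u
    have h2 := hself v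
    have h3 := hself w
    have h4 := hne u v huv
    have h5 := hne u w huw
    rw [hu] at h1 h4 h5
    rw [hv] at h2 h4
    rw [hw] at h3 h5
    have hcr : ((H.neighborFinset u ∩ H.neighborFinset v).card : ℝ) = d - 1 := by
      rw [← hc]; push_cast; ring
    have hd3' : (d : ℝ) ≤ 3 := by exact_mod_cast hd3
    have hlt' : ((H.neighborFinset u ∩ H.neighborFinset w).card : ℝ) + 2 ≤ d := by
      exact_mod_cast hlt
    rw [hcr] at h4
    -- With `d - 1` common neighbours the vectors of `u` and `v` are at distance zero.
    have hyy : y u = y v := by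
      have : (x u - x v) ^ 2 + (y u - y v) ^ 2 = 0 := by linear_combination h1 + h2 - 2 * h4
      have h0 : (y u - y v) ^ 2 = 0 := by
        linarith [sq_nonneg (x u - x v), sq_nonneg (y u - y v)]
      exact sub_eq_zero.1 (pow_eq_zero_iff two_ne_zero |>.1 h0)
    have hsum : 2 * y u ^ 2 + y w ^ 2 ≤ 5 / 4 := by
      refine le_trans ?_ hy
      have hsub := Finset.sum_le_sum_of_subset_of_nonneg (Finset.subset_univ {u, v, w})
        (f := fun z => y z ^ 2) fun z _ _ => sq_nonneg _
      rw [Finset.sum_insert (by simp [huv, huw]), Finset.sum_pair hvw, ← hyy] at hsub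
      linarith
    have hnn : (0 : ℝ) ≤ (H.neighborFinset u ∩ H.neighborFinset w).card := Nat.cast_nonneg _
    exact false_of_planar_twins (a := 8 * (k : ℝ) + 3 - 3 * d)
      (s := d - 1 - (H.neighborFinset u ∩ H.neighborFinset w).card)
      (by linarith) (by linarith) (by linarith) le_rfl h1 h3 (by linarith) hsum
  · intro u v w d huv huw hvw hd3 hu hv hw hc1 hc2 hc3
    have h1 := hself u
    have h2 := hself v
    have h3 := hself w
    have h4 := hne u v huv
    have h5 := hne u w huw
    have h6 := hne v w hvw
    have hd3' : (d : ℝ) ≤ 3 := by exact_mod_cast hd3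
    have e1 : ((H.neighborFinset u ∩ H.neighborFinset v).card : ℝ) = d - 2 := by
      rw [← hc1]; push_cast; ring
    have e2 : ((H.neighborFinset u ∩ H.neighborFinset w).card : ℝ) = d - 2 := by
      rw [← hc2]; push_cast; ring
    have e3 : ((H.neighborFinset v ∩ H.neighborFinset w).card : ℝ) = d - 2 := by
      rw [← hc3]; push_cast; ring
    rw [e1, hu, hv] at h4
    rw [e2, hu, hw] at h5
    rw [e3, hv, hw] at h6
    rw [hu] at h1
    rw [hv] at h2
    rw [hw] at h3
    exact false_of_planar_equilateral (a := 8 * (k : ℝ) + 3 - 3 * d) (by linarith)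
      ((by ring : x u * x u + y u * y u = x u ^ 2 + y u ^ 2).trans h1)
      ((by ring : x v * x v + y v * y v = x v ^ 2 + y v ^ 2).trans h2)
      ((by ring : x w * x w + y w * y w = x w ^ 2 + y w ^ 2).trans h3)
      (h4.trans (by ring)) (h5.trans (by ring)) (h6.trans (by ring))

end

end SimpleGraph

theorem theorem3p6 (k : ℕ) (hk : 1 ≤ k) :
    SimpleGraph.IsDeterminedByDistanceSpectrum.{0, v} (friendshipGraph k) := by
  classical
  intro W _ _ H hH h
  have hcard := SimpleGraph.card_eq_of_distanceSpectrum_eq_friendshipGraph h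
  have hd := SimpleGraph.dist_le_two_of_posSemidef hH
    (SimpleGraph.posSemidef_distanceMatrix_add_of_distanceSpectrum_eq h
      posSemidef_distanceMatrix_friendshipGraph)
  -- The plane estimate needs `8k + 3 - 3d ≥ 9` for `d ≤ 3`, which can fail for `k = 1`; there the
  -- degree sum six on three vertices already forces a triangle.
  obtain rfl | hk2 : k = 1 ∨ 2 ≤ k := by omega
  · have hsum := SimpleGraph.sum_degree_of_distanceSpectrum_eq hH hd h
    have hdeg : ∀ v, H.degree v = 2 := by
      have hle : ∀ v ∈ Finset.univ, H.degree v ≤ 2 := fun v _ => by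
        have := H.degree_lt_card_verts v
        omega
      have := (Finset.sum_eq_sum_iff_of_le hle).1 (by
        rw [hsum, Finset.sum_const, Finset.card_univ, hcard]; rfl)
      exact fun v => this v (Finset.mem_univ v)
    obtain ⟨w⟩ := hH.nonempty
    refine SimpleGraph.nonempty_iso_friendshipGraph hcard (w := w) (fun v hv => ?_)
      fun v _ => hdeg v
    have : H.neighborFinset w = Finset.univ.erase w :=
      Finset.eq_of_subset_of_card_le (fun z hz => by
        simpa using ((H.mem_neighborFinset w z).1 hz).ne') (by
        rw [Finset.card_erase_of_mem (Finset.mem_univ w), Finset.card_univ, hcard,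
          SimpleGraph.card_neighborFinset_eq_degree, hdeg])
    rw [← SimpleGraph.mem_neighborFinset, this]
    simpa using hv
  · have hG := SimpleGraph.friendshipLike_of_distanceSpectrum_eq hk2 hH hd h
    obtain ⟨w, hw⟩ := hG.exists_dominating
    exact SimpleGraph.nonempty_iso_friendshipGraph hcard hw fun v hv =>
      hG.degree_eq_two_of_dominating hw hv
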